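/- **Lemma 5.1.** Let $X$ be a Tychonoff space that is $F_\sigma$-quotient, i.e. there are a compact metrizable space $K$, an $F_\sigma$-subset $M\subset K$ (with the subspace topology) and a surjective quotient map $q:M\to X$. Then the function spaces $C_p(X)$ and $C_k(X)$ are $F_\sigma$-Lusin, and $C_{\downarrow F}(X)$ is $C_{\delta\sigma}$-Lusin. Here $C_p(X)$, $C_k(X)$ and $C_{\downarrow F}(X)$ denote the set $C(X)$ of continuous functions $f:X\to\mathbb R$ endowed, respectively, with the topology of pointwise convergence, with the compact-open topology, and with the Fell hypograph topology, which is generated by the subbase of all sets $\{f\in C(X):\max f(K)<r\}$ and $\{f\in C(X):\sup f(U)>r\}$, where $K\subset X$ is nonempty and compact, $U\subset X$ is nonempty and open, and $r\in\mathbb R$. For a class $\Gamma$ of sets in topological spaces, a topological space $Y$ is called $\Gamma$-Lusin if there are a Polish space $P$ and a continuous bijection $\xi:P\to Y$ such that for every open $U\subset P$ the set $(\xi^{-1})^{-1}(U)=\xi(U)$ is of class $\Gamma$ in $Y$. An $F_\sigma$-set is a countable union of closed sets; a constructible set is a member of the smallest algebra of sets containing all open sets; a $C_\delta$-set is a countable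 intersection of constructible sets; a $C_{\delta\sigma}$-set is a countable union of $C_\delta$-sets. -/

import Mathlib

open Set Topology

universe u

namespace FunctionSpaceLusin

/-- A class `Γ` of sets in topological spaces: for each topological space, a property of its
subsets. -/
abbrev SetClass : Type (u + 1) := ∀ (Z : Type u) [TopologicalSpace Z], Set Z → Prop

/-- `F_σ`-sets: countable unions of closed sets. -/
def FSigma : SetClass.{u} := fun Z _ A =>
  ∃ F : ℕ → Set Z, (∀ n, IsClosed (F n)) ∧ A = ⋃ n, F n

/-- Constructible sets: members of the smallest algebra of sets containing all open sets.
(This is not `Topology.IsConstructible`, which starts from retrocompact open sets.) -/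
def Constructible : SetClass.{u} := fun Z _ A =>
  A ∈ MeasureTheory.generateSetAlgebra {U : Set Z | IsOpen U}

/-- `C_δ`-sets: countable intersections of constructible sets. -/
def CDelta : SetClass.{u} := fun Z _ A =>
  ∃ C : ℕ → Set Z, (∀ n, Constructible Z (C n)) ∧ A = ⋂ n, C n

/-- `C_δσ`-sets: countable unions of `C_δ`-sets. -/
def CDeltaSigma : SetClass.{u} := fun Z _ A =>
  ∃ C : ℕ → Set Z, (∀ n, CDelta Z (C n)) ∧ A = ⋃ n, C n

/-- A map is `Γ`-measurable if preimages of open sets are of class `Γ`. -/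
def ClassMeasurable (Γ : SetClass.{u}) {Y Z : Type u} [TopologicalSpace Y] [TopologicalSpace Z]
    (f : Y → Z) : Prop :=
  ∀ U : Set Z, IsOpen U → Γ Y (f ⁻¹' U)

/-- `Y` is `Γ`-Lusin: it is the image of a Polish space `P` under a continuous bijection whose
inverse map `Y → P` is `Γ`-measurable. -/
def IsLusinOfClass (Γ : SetClass.{u}) (Y : Type u) [TopologicalSpace Y] : Prop :=
  ∃ (P : Type u) (_ : TopologicalSpace P) (_ : PolishSpace P) (ξ : P ≃ Y),
    Continuous ξ ∧ ClassMeasurable Γ ξ.symm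

/-- `X` is `Γ`-quotient: it is the image, under a surjective quotient map, of a subspace of
class `Γ` of a compact metrizable space. (Compact metrizable spaces have at most continuum many
points, so the choice of the universe of `K` does not matter.) -/
def IsQuotientOfClass (Γ : SetClass.{u}) (X : Type u) [TopologicalSpace X] : Prop :=
  ∃ (K : Type u) (_ : TopologicalSpace K) (_ : CompactSpace K)
    (_ : TopologicalSpace.MetrizableSpace K) (M : Set K) (q : M → X),
    Γ K M ∧ IsQuotientMap q

/-- `C_p(X)`: the continuous real-valued functions on `X`, with the topology of pointwise
convergence. -/
def Cp (X : Type u) [TopologicalSpace X] : Type u := C(X, ℝ)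

instance (X : Type u) [TopologicalSpace X] : FunLike (Cp X) X ℝ :=
  inferInstanceAs (FunLike C(X, ℝ) X ℝ)

instance (X : Type u) [TopologicalSpace X] : TopologicalSpace (Cp X) :=
  TopologicalSpace.induced (fun (f : Cp X) (x : X) => f x) Pi.topologicalSpace

/-- `C_k(X)`: the continuous real-valued functions on `X`, with the compact-open topology, which
is Mathlib's topology on `C(X, ℝ)`. -/
abbrev Ck (X : Type u) [TopologicalSpace X] : Type u := C(X, ℝ)

/-- `C_{↓F}(X)`: the continuous real-valued functions on `X`, with the Fell hypograph topology. -/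
def CFell (X : Type u) [TopologicalSpace X] : Type u := C(X, ℝ)

instance (X : Type u) [TopologicalSpace X] : FunLike (CFell X) X ℝ :=
  inferInstanceAs (FunLike C(X, ℝ) X ℝ)

/-- The Fell hypograph topology has as a subbase the sets `{f | max f(K) < r}`, with `K` nonempty
and compact, and `{f | sup f(U) > r}`, with `U` nonempty and open, for real `r`. As the maximum is
attained, `max f(K) < r` means `f x < r` on `K`; as `sup f(U) ∈ (-∞, ∞]` is a least upper bound,
`sup f(U) > r` means `r < f x` for some `x ∈ U`. -/
instance (X : Type u) [TopologicalSpace X] : TopologicalSpace (CFell X) :=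
  TopologicalSpace.generateFrom
    ({S | ∃ (K : Set X) (r : ℝ), IsCompact K ∧ K.Nonempty ∧ S = {f : CFell X | ∀ x ∈ K, f x < r}} ∪
     {S | ∃ (U : Set X) (r : ℝ), IsOpen U ∧ U.Nonempty ∧ S = {f : CFell X | ∃ x ∈ U, r < f x}})

end FunctionSpaceLusin

/-! An F_σ-subset of a compact space is σ-compact, so `M` is a union of compact sets `S n`; fix a
countable dense `D ⊆ M`. Code `f ∈ C(X)` by the values of `f ∘ q` on `D` together with, for all `n`
and `m`, the least `k` such that `f ∘ q` oscillates by at most `1/(m+1)` on every ball of radius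
`1/(k+1)` centred in `S n`. The code determines `f`.

Recording the moduli as discrete coordinates makes the set of codes closed intersected with
countably many open sets (`range_encode`), hence Polish, and makes evaluation jointly continuous in
code and point. Decoding is therefore continuous into the compact-open topology
(`continuous_decode`), and into the two coarser ones.

For the inverse, each coordinate of the code is governed by countably many conditions on `f x` and
`|f a - f b|` (`preimage_encode_mem`). These are F_σ for `C_p` and `C_k`, and C_δσ for the Fell
topology, where `{f | f x < r}` is open and `|f a - f b| ≤ c` defines a C_δ-set. -/

namespace FunctionSpaceLusin

/-! ### Measurability with respect to a σ-lattice of sets -/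

/-- A family of sets closed under finite intersections and countable unions. -/
structure IsSigmaLattice {Y : Type*} (𝓕 : Set (Set Y)) : Prop where
  empty_mem : ∅ ∈ 𝓕
  univ_mem : univ ∈ 𝓕
  inter_mem : ∀ {A B : Set Y}, A ∈ 𝓕 → B ∈ 𝓕 → A ∩ B ∈ 𝓕
  iUnion_nat_mem : ∀ {A : ℕ → Set Y}, (∀ n, A n ∈ 𝓕) → ⋃ n, A n ∈ 𝓕

namespace IsSigmaLattice

variable {Y Z W : Type*} {𝓕 : Set (Set Y)}

theorem iUnion_mem (h : IsSigmaLattice 𝓕) {ι : Type*} [Countable ι] {A : ι → Set Y}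
    (hA : ∀ i, A i ∈ 𝓕) : ⋃ i, A i ∈ 𝓕 := by
  cases isEmpty_or_nonempty ι
  · simpa using h.empty_mem
  · obtain ⟨g, hg⟩ := exists_surjective_nat ι
    rw [← hg.iUnion_comp]
    exact h.iUnion_nat_mem fun n => hA _

theorem union_mem (h : IsSigmaLattice 𝓕) {A B : Set Y} (hA : A ∈ 𝓕) (hB : B ∈ 𝓕) :
    A ∪ B ∈ 𝓕 := by
  rw [union_eq_iUnion]
  exact h.iUnion_mem fun b => by cases b <;> assumption

theorem biInter_finset_mem (h : IsSigmaLattice 𝓕) {ι : Type*} (s : Finset ι) {A : ι → Set Y}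
    (hA : ∀ i ∈ s, A i ∈ 𝓕) : ⋂ i ∈ s, A i ∈ 𝓕 := by
  classical
  induction s using Finset.induction_on with
  | empty => simpa using h.univ_mem
  | insert a s _ ih =>
    rw [Finset.set_biInter_insert]
    exact h.inter_mem (hA a (Finset.mem_insert_self a s))
      (ih fun i hi => hA i (Finset.mem_insert_of_mem hi))

theorem preimage_mem_of_basis (h : IsSigmaLattice 𝓕) [TopologicalSpace Z]
    [SecondCountableTopology Z] {B : Set (Set Z)} (hB : TopologicalSpace.IsTopologicalBasis B)
    {f : Y → Z} (hf : ∀ b ∈ B, f ⁻¹' b ∈ 𝓕) {U : Set Z} (hU : IsOpen U) : f ⁻¹' U ∈ 𝓕 := by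
  obtain ⟨S, hSB, rfl⟩ := hB.open_eq_sUnion hU
  obtain ⟨T, hT, hTS, hTU⟩ :=
    TopologicalSpace.isOpen_sUnion_countable S fun s hs => hB.isOpen (hSB hs)
  rw [← hTU, sUnion_eq_iUnion, preimage_iUnion]
  have := hT.to_subtype
  exact h.iUnion_mem fun t => hf _ (hSB (hTS t.2))

theorem preimage_mem_of_real (h : IsSigmaLattice 𝓕) {f : Y → ℝ}
    (hlt : ∀ r, {y | f y < r} ∈ 𝓕) (hgt : ∀ r, {y | r < f y} ∈ 𝓕) {U : Set ℝ} (hU : IsOpen U) :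
    f ⁻¹' U ∈ 𝓕 := by
  refine h.preimage_mem_of_basis Real.isTopologicalBasis_Ioo_rat ?_ hU
  intro b hb
  simp only [mem_iUnion, mem_singleton_iff] at hb
  obtain ⟨a, c, -, rfl⟩ := hb
  exact h.inter_mem (hgt a) (hlt c)

theorem preimage_mem_of_nat (h : IsSigmaLattice 𝓕) {f : Y → ℕ}
    (hf : ∀ k, {y | f y = k} ∈ 𝓕) {U : Set ℕ} : f ⁻¹' U ∈ 𝓕 := by
  have : f ⁻¹' U = ⋃ k : U, {y | f y = k} := by ext; simp
  rw [this]
  exact h.iUnion_mem fun k => hf k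

theorem preimage_prodMk_mem (h : IsSigmaLattice 𝓕) [TopologicalSpace Z] [TopologicalSpace W]
    [SecondCountableTopology Z] [SecondCountableTopology W] {f : Y → Z} {g : Y → W}
    (hf : ∀ U, IsOpen U → f ⁻¹' U ∈ 𝓕) (hg : ∀ U, IsOpen U → g ⁻¹' U ∈ 𝓕)
    {U : Set (Z × W)} (hU : IsOpen U) : (fun y => (f y, g y)) ⁻¹' U ∈ 𝓕 := by
  refine h.preimage_mem_of_basis (TopologicalSpace.isTopologicalBasis_opens.prod
    TopologicalSpace.isTopologicalBasis_opens) ?_ hU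
  rintro _ ⟨V, hV, V', hV', rfl⟩
  exact h.inter_mem (hf V hV) (hg V' hV')

theorem preimage_pi_mem (h : IsSigmaLattice 𝓕) {ι : Type*} [Countable ι] [TopologicalSpace Z]
    [SecondCountableTopology Z] {f : Y → ι → Z} (hf : ∀ i U, IsOpen U → (f · i) ⁻¹' U ∈ 𝓕)
    {U : Set (ι → Z)} (hU : IsOpen U) : f ⁻¹' U ∈ 𝓕 := by
  refine h.preimage_mem_of_basis (isTopologicalBasis_pi fun _ : ι =>
    TopologicalSpace.isTopologicalBasis_opens (α := Z)) ?_ hU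
  rintro _ ⟨V, F, hV, rfl⟩
  have : f ⁻¹' (F : Set ι).pi V = ⋂ i ∈ F, (f · i) ⁻¹' V i := by ext; simp
  rw [this]
  exact h.biInter_finset_mem F fun i hi => hf i _ (hV i hi)

end IsSigmaLattice

/-! ### The classes F_σ and C_δσ -/

section Classes

variable {Y : Type u} [TopologicalSpace Y]

theorem _root_.IsClosed.fSigma {A : Set Y} (hA : IsClosed A) : FSigma Y A :=
  ⟨fun _ => A, fun _ => hA, (iUnion_const A).symm⟩

theorem isSigmaLattice_fSigma : IsSigmaLattice {A : Set Y | FSigma Y A} where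
  empty_mem := isClosed_empty.fSigma
  univ_mem := isClosed_univ.fSigma
  inter_mem := by
    rintro _ _ ⟨F, hF, rfl⟩ ⟨G, hG, rfl⟩
    refine ⟨fun n => F n.unpair.1 ∩ G n.unpair.2, fun n => (hF _).inter (hG _), ?_⟩
    rw [iUnion_inter_iUnion, iUnion_unpair fun i j => F i ∩ G j]
  iUnion_nat_mem := by
    intro A hA
    choose F hF hAF using hA
    refine ⟨fun n => F n.unpair.1 n.unpair.2, fun n => hF _ _, ?_⟩
    rw [iUnion_unpair F]
    exact iUnion_congr hAF

theorem Constructible.of_isOpen {A : Set Y} (hA : IsOpen A) : Constructible Y A :=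
  MeasureTheory.self_subset_generateSetAlgebra hA

theorem Constructible.compl {A : Set Y} (hA : Constructible Y A) : Constructible Y Aᶜ :=
  MeasureTheory.isSetAlgebra_generateSetAlgebra.compl_mem hA

theorem Constructible.inter {A B : Set Y} (hA : Constructible Y A) (hB : Constructible Y B) :
    Constructible Y (A ∩ B) :=
  MeasureTheory.isSetAlgebra_generateSetAlgebra.inter_mem hA hB

theorem Constructible.cDelta {A : Set Y} (hA : Constructible Y A) : CDelta Y A :=
  ⟨fun _ => A, fun _ => hA, (iInter_const A).symm⟩

theorem CDelta.cDeltaSigma {A : Set Y} (hA : CDelta Y A) : CDeltaSigma Y A :=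
  ⟨fun _ => A, fun _ => hA, (iUnion_const A).symm⟩

theorem CDelta.iInter {ι : Type*} [Countable ι] {A : ι → Set Y}
    (hA : ∀ i, CDelta Y (A i)) : CDelta Y (⋂ i, A i) := by
  cases isEmpty_or_nonempty ι
  · simpa using (Constructible.of_isOpen (Y := Y) isOpen_univ).cDelta
  · obtain ⟨g, hg⟩ := exists_surjective_nat ι
    rw [← hg.iInter_comp]
    choose C hC hAC using hA
    refine ⟨fun n => C (g n.unpair.1) n.unpair.2, fun n => hC _ _, ?_⟩
    rw [iInter_unpair fun i j => C (g i) j]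
    exact iInter_congr fun i => hAC _

theorem CDelta.inter {A B : Set Y} (hA : CDelta Y A) (hB : CDelta Y B) : CDelta Y (A ∩ B) := by
  rw [inter_eq_iInter]
  exact CDelta.iInter fun b => by cases b <;> assumption

theorem isSigmaLattice_cDeltaSigma : IsSigmaLattice {A : Set Y | CDeltaSigma Y A} where
  empty_mem := (Constructible.of_isOpen isOpen_empty).cDelta.cDeltaSigma
  univ_mem := (Constructible.of_isOpen isOpen_univ).cDelta.cDeltaSigma
  inter_mem := by
    rintro _ _ ⟨F, hF, rfl⟩ ⟨G, hG, rfl⟩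
    refine ⟨fun n => F n.unpair.1 ∩ G n.unpair.2, fun n => (hF _).inter (hG _), ?_⟩
    rw [iUnion_inter_iUnion, iUnion_unpair fun i j => F i ∩ G j]
  iUnion_nat_mem := by
    intro A hA
    choose F hF hAF using hA
    refine ⟨fun n => F n.unpair.1 n.unpair.2, fun n => hF _ _, ?_⟩
    rw [iUnion_unpair F]
    exact iUnion_congr hAF

end Classes

/-! ### Rational separation and Polish subspaces -/

theorem lt_abs_sub_iff_exists_rat {a b c : ℝ} :
    c < |a - b| ↔ ∃ r : ℚ, (r + c < a ∧ b < r) ∨ (r + c < b ∧ a < r) := by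
  constructor
  · intro h
    rcases lt_abs.1 h with h | h
    · obtain ⟨r, h1, h2⟩ := exists_rat_btwn (show b < a - c by linarith)
      exact ⟨r, .inl ⟨by linarith, h1⟩⟩
    · obtain ⟨r, h1, h2⟩ := exists_rat_btwn (show a < b - c by linarith)
      exact ⟨r, .inr ⟨by linarith, h1⟩⟩
  · rintro ⟨r, h | h⟩
    · exact lt_abs.2 (.inl (by linarith [h.1, h.2]))
    · exact lt_abs.2 (.inr (by linarith [h.1, h.2]))

/-- The diagonal map into the Polish product of `C` and all `U i` is an embedding; its range is
closed, being the set where all coordinates agree. -/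
theorem polishSpace_inter_iInter {Z ι : Type*} [TopologicalSpace Z] [PolishSpace Z] [Countable ι]
    {C : Set Z} {U : ι → Set Z} (hC : IsClosed C) (hU : ∀ i, IsOpen (U i)) :
    PolishSpace ↥(C ∩ ⋂ i, U i) := by
  have := hC.polishSpace
  have := fun i => (hU i).polishSpace
  let g : ↥(C ∩ ⋂ i, U i) → C × (∀ i, U i) :=
    fun z => (⟨z, z.2.1⟩, fun i => ⟨z, mem_iInter.1 z.2.2 i⟩)
  have hg : Continuous g := by fun_prop
  have hrange : range g = {w | ∀ i, (w.2 i : Z) = w.1} := by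
    ext w
    constructor
    · rintro ⟨z, rfl⟩ i
      rfl
    · intro hw
      refine ⟨⟨w.1, w.1.2, mem_iInter.2 fun i => hw i ▸ (w.2 i).2⟩, ?_⟩
      ext i
      · rfl
      · exact (hw i).symm
  have hemb : IsEmbedding g := by
    refine IsEmbedding.of_comp hg (g := fun w => (w.1 : Z)) (by fun_prop) ?_
    exact IsEmbedding.subtypeVal
  refine IsClosedEmbedding.polishSpace (f := g) ⟨hemb, ?_⟩
  rw [hrange, ofPred_forall]
  exact isClosed_iInter fun i => isClosed_eq (by fun_prop) (by fun_prop)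

end FunctionSpaceLusin
namespace FunctionSpaceLusin

/-! ### Oscillation moduli and extension from a dense set -/

section Oscillation

variable {M : Type*} [PseudoMetricSpace M] {D : Set M}

/-- The function `φ` oscillates by at most `1 / (m + 1)` on the trace on `D` of each ball of radius
`1 / (k + 1)` centred at a point of `S`. -/
def OscLE (S : Set M) (m k : ℕ) (φ : D → ℝ) : Prop :=
  ∀ x ∈ S, ∀ y y' : D, dist (y : M) x < 1 / (k + 1 : ℝ) → dist (y' : M) x < 1 / (k + 1 : ℝ) →
    |φ y - φ y'| ≤ 1 / (m + 1 : ℝ)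

/-- The least `k` for which `OscLE S m k φ` holds. -/
noncomputable def oscIndex (S : Set M) (m : ℕ) (φ : D → ℝ) : ℕ :=
  sInf {k | OscLE S m k φ}

/-- The existence hypothesis excludes the default value `sInf ∅ = 0`. -/
theorem oscIndex_eq_iff {S : Set M} {m : ℕ} {φ : D → ℝ} (h : ∃ k, OscLE S m k φ) {k : ℕ} :
    oscIndex S m φ = k ↔ OscLE S m k φ ∧ ∀ j < k, ¬ OscLE S m j φ := by
  constructor
  · rintro rfl
    exact ⟨Nat.sInf_mem h, fun j hj => Nat.notMem_of_lt_sInf hj⟩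
  · rintro ⟨h1, h2⟩
    exact le_antisymm (Nat.sInf_le h1) (not_lt.1 fun hlt => h2 _ hlt (Nat.sInf_mem h))

theorem exists_oscLE {S : Set M} (hS : IsCompact S) {g : M → ℝ} (hg : Continuous g) (m : ℕ) :
    ∃ k, OscLE S m k (fun y : D => g y) := by
  -- Half the tolerance, since `g y` and `g y'` are compared through `g x`.
  have hm : (0 : ℝ) < 1 / (m + 1) / 2 := by positivity
  have h := hS.uniformContinuousAt_of_continuousAt g (fun a _ => hg.continuousAt)
    (Metric.dist_mem_uniformity hm)
  obtain ⟨δ, hδ, hsub⟩ := Metric.mem_uniformity_dist.1 h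
  obtain ⟨k, hk⟩ := exists_nat_one_div_lt hδ
  refine ⟨k, fun x hx y y' hy hy' => ?_⟩
  have h1 : dist (g x) (g y) < _ := hsub ((dist_comm _ _).trans_lt (hy.trans hk)) hx
  have h2 : dist (g x) (g y') < _ := hsub ((dist_comm _ _).trans_lt (hy'.trans hk)) hx
  have := dist_triangle_left (g y) (g y') (g x)
  rw [← Real.dist_eq]
  linarith

theorem abs_sub_le_of_dense (hD : Dense D) {g : M → ℝ} (hg : Continuous g) {U U' : Set M}
    (hU : IsOpen U) (hU' : IsOpen U') {c : ℝ}
    (h : ∀ y y' : D, (y : M) ∈ U → (y' : M) ∈ U' → |g y - g y'| ≤ c) {z z' : M} (hz : z ∈ U)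
    (hz' : z' ∈ U') : |g z - g z'| ≤ c := by
  have hcl : IsClosed {p : M × M | |g p.1 - g p.2| ≤ c} :=
    isClosed_le (by fun_prop) continuous_const
  have hsub : (U ×ˢ U') ∩ (D ×ˢ D) ⊆ {p : M × M | |g p.1 - g p.2| ≤ c} :=
    fun p hp => h ⟨p.1, hp.2.1⟩ ⟨p.2, hp.2.2⟩ hp.1.1 hp.1.2
  exact closure_minimal hsub hcl
    ((hD.prod hD).open_subset_closure_inter (hU.prod hU') (Set.mk_mem_prod hz hz'))

theorem OscLE.abs_sub_le (hD : Dense D) {g : M → ℝ} (hg : Continuous g) {S : Set M} {m k : ℕ}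
    (h : OscLE S m k (fun y : D => g y)) {x : M} (hx : x ∈ S) {z z' : M}
    (hz : z ∈ Metric.ball x (1 / (k + 1 : ℝ))) (hz' : z' ∈ Metric.ball x (1 / (k + 1 : ℝ))) :
    |g z - g z'| ≤ 1 / (m + 1 : ℝ) :=
  abs_sub_le_of_dense hD hg Metric.isOpen_ball Metric.isOpen_ball
    (fun y y' hy hy' => h x hx y y' hy hy') hz hz'

theorem isClosed_oscLE (S : Set M) (m k : ℕ) : IsClosed {φ : D → ℝ | OscLE S m k φ} := by
  simp only [OscLE, ofPred_forall]
  refine isClosed_iInter fun x => isClosed_iInter fun _ => isClosed_iInter fun y =>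
    isClosed_iInter fun y' => isClosed_iInter fun _ => isClosed_iInter fun _ => ?_
  exact isClosed_le (by fun_prop) continuous_const

/-- The oscillation bounds make `φ` Cauchy along the trace on `D` of every neighbourhood filter;
completeness of `ℝ` supplies the limits. -/
theorem exists_continuous_extension (hD : Dense D) {S : ℕ → Set M} (hcov : ⋃ n, S n = univ)
    {φ : D → ℝ} (h : ∀ n m, ∃ k, OscLE (S n) m k φ) :
    ∃ g : M → ℝ, Continuous g ∧ ∀ y : D, g y = φ y := by
  have hlim : ∀ x : M, ∃ c, Filter.Tendsto φ (Filter.comap Subtype.val (𝓝 x)) (𝓝 c) := by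
    intro x
    have : (Filter.comap (Subtype.val : D → M) (𝓝 x)).NeBot := 
      hD.isDenseInducing_val.comap_nhds_neBot x
    refine cauchy_map_iff_exists_tendsto.1 (Metric.cauchy_iff.2 ⟨inferInstance, fun ε hε => ?_⟩)
    obtain ⟨n, hn⟩ := mem_iUnion.1 (hcov ▸ mem_univ x)
    obtain ⟨m, hm⟩ := exists_nat_one_div_lt hε
    obtain ⟨k, hk⟩ := h n m
    refine ⟨φ '' (Subtype.val ⁻¹' Metric.ball x (1 / (k + 1 : ℝ))), Filter.image_mem_map
      (Filter.preimage_mem_comap (Metric.ball_mem_nhds x (by positivity))), ?_⟩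
    rintro _ ⟨y, hy, rfl⟩ _ ⟨y', hy', rfl⟩
    exact (hk x hn y y' hy hy').trans_lt hm
  refine ⟨hD.isDenseInducing_val.extend φ, hD.isDenseInducing_val.continuous_extend hlim,
    fun y => ?_⟩
  obtain ⟨c, hc⟩ := hlim y
  rw [← hD.isDenseInducing_val.isInducing.nhds_eq_comap] at hc
  exact hD.isDenseInducing_val.extend_eq_at' c hc

end Oscillation

theorem isClopen_setOf_index {ι : Type*} (R : ℕ → ℕ → Prop) (n n' m : ℕ) :
    IsClopen {p : (ι → ℝ) × (ℕ → ℕ → ℕ) | R (p.2 n m) (p.2 n' m)} :=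
  (isClopen_discrete {r : ℕ × ℕ | R r.1 r.2}).preimage
    (f := fun p : (ι → ℝ) × (ℕ → ℕ → ℕ) => (p.2 n m, p.2 n' m)) (by fun_prop)

/-! ### Coding continuous functions by a Polish space -/

section Encoding

variable {M : Type*} [PseudoMetricSpace M] {X : Type*} [TopologicalSpace X]

/-- Encodes a continuous function on `X` by its values at the `q`-images of the points of `D`,
together with its oscillation indices with respect to the sets `S n`. -/
noncomputable def encode (D : Set M) (S : ℕ → Set M) (q : M → X) (f : C(X, ℝ)) :
    (D → ℝ) × (ℕ → ℕ → ℕ) :=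
  (fun y => f (q y), fun n m => oscIndex (S n) m fun y : D => f (q y))

variable {D : Set M} {S : ℕ → Set M} {q : M → X}

theorem encode_injective (hD : Dense D) (hq : IsQuotientMap q) :
    Function.Injective (encode D S q) := by
  intro f f' h
  have h1 : EqOn (f ∘ q) (f' ∘ q) D := fun y hy => congrFun (congrArg Prod.fst h) ⟨y, hy⟩
  have h2 := Continuous.ext_on hD (f.continuous.comp hq.continuous)
    (f'.continuous.comp hq.continuous) h1
  ext x
  obtain ⟨z, rfl⟩ := hq.surjective x
  exact congrFun h2 z

theorem oscLE_encode (hq : IsQuotientMap q) (hS : ∀ n, IsCompact (S n)) (f : C(X, ℝ)) (n m : ℕ) :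
    OscLE (S n) m ((encode D S q f).2 n m) (encode D S q f).1 :=
  ((oscIndex_eq_iff (exists_oscLE (hS n) (f.continuous.comp hq.continuous) m)).1 rfl).1

/-- The first condition extends `φ` continuously to `M`, the second makes the extension constant on
the fibres of `q`, so that it descends to `X`, and the third forces the moduli to be the least ones.
The bound `2/(m+1)` is one `1/(m+1)` for each of the two balls. -/
theorem range_encode (hD : Dense D) (hS : ∀ n, IsCompact (S n)) (hcov : ⋃ n, S n = univ)
    (hq : IsQuotientMap q) :
    range (encode D S q) =
      ({p | ∀ n m, OscLE (S n) m (p.2 n m) p.1} ∩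
        {p | ∀ n n' m : ℕ, ∀ x ∈ S n, ∀ x' ∈ S n', q x = q x' → ∀ y y' : D,
          dist (y : M) x < 1 / (p.2 n m + 1 : ℝ) → dist (y' : M) x' < 1 / (p.2 n' m + 1 : ℝ) →
            |p.1 y - p.1 y'| ≤ 2 / (m + 1 : ℝ)}) ∩
      ⋂ i : ℕ × ℕ, {p | ∀ j < p.2 i.1 i.2, ¬ OscLE (S i.1) i.2 j p.1} := by
  apply Subset.antisymm
  · rintro _ ⟨f, rfl⟩
    have hg : Continuous fun z => f (q z) := f.continuous.comp hq.continuous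
    refine ⟨⟨oscLE_encode hq hS f, ?_⟩, mem_iInter.2 fun i =>
      ((oscIndex_eq_iff (exists_oscLE (hS i.1) hg i.2)).1 rfl).2⟩
    intro n n' m x hx x' hx' hxx' y y' hy hy'
    have h1 : |f (q y) - f (q x)| ≤ _ := OscLE.abs_sub_le hD hg (oscLE_encode hq hS f n m) hx hy
      (Metric.mem_ball_self (by positivity))
    have h2 : |f (q y') - f (q x')| ≤ _ := OscLE.abs_sub_le hD hg (oscLE_encode hq hS f n' m) hx' hy'
      (Metric.mem_ball_self (by positivity))
    rw [hxx'] at h1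
    have h3 := abs_sub_le (f (q y)) (f (q x')) (f (q y'))
    rw [abs_sub_comm (f (q x'))] at h3
    have : 2 / (m + 1 : ℝ) = 1 / (m + 1 : ℝ) + 1 / (m + 1 : ℝ) := by ring
    show |f (q y) - f (q y')| ≤ _
    linarith
  · rintro ⟨φ, α⟩ ⟨⟨h1, h2⟩, h3⟩
    obtain ⟨g, hg, hgφ⟩ := exists_continuous_extension hD hcov fun n m => ⟨_, h1 n m⟩
    have hfib : ∀ x x', q x = q x' → g x = g x' := by
      intro x x' hxx'
      obtain ⟨n, hn⟩ := mem_iUnion.1 (hcov ▸ mem_univ x)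
      obtain ⟨n', hn'⟩ := mem_iUnion.1 (hcov ▸ mem_univ x')
      refine eq_of_forall_dist_le fun ε hε => ?_
      obtain ⟨m, hm⟩ := exists_nat_one_div_lt (half_pos hε)
      have h4 := abs_sub_le_of_dense hD hg
        (Metric.isOpen_ball (x := x) (ε := 1 / (α n m + 1 : ℝ)))
        (Metric.isOpen_ball (x := x') (ε := 1 / (α n' m + 1 : ℝ))) (fun y y' hy hy' => by
          rw [hgφ, hgφ]
          exact h2 n n' m x hn x' hn' hxx' y y' hy hy')
        (Metric.mem_ball_self (by positivity)) (Metric.mem_ball_self (by positivity))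
      have : 2 / (m + 1 : ℝ) = 2 * (1 / (m + 1 : ℝ)) := by ring
      rw [Real.dist_eq]
      linarith
    have hq' : IsQuotientMap (⟨q, hq.continuous⟩ : C(M, X)) := hq
    let f : C(X, ℝ) := hq'.lift ⟨g, hg⟩ hfib
    have hf : ∀ z, f (q z) = g z := fun z => DFunLike.congr_fun (hq'.lift_comp ⟨g, hg⟩ hfib) z
    have hφ : (fun y : D => f (q y)) = φ := funext fun y => (hf y).trans (hgφ y)
    refine ⟨f, Prod.ext hφ ?_⟩
    funext n m
    change oscIndex (S n) m (fun y : D => f (q y)) = α n m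
    rw [hφ]
    exact (oscIndex_eq_iff ⟨_, h1 n m⟩).2 ⟨h1 n m, mem_iInter.1 h3 (n, m)⟩

theorem polishSpace_range_encode (hD : Dense D) (hDc : D.Countable) (hS : ∀ n, IsCompact (S n))
    (hcov : ⋃ n, S n = univ) (hq : IsQuotientMap q) : PolishSpace (range (encode D S q)) := by
  have := hDc.to_subtype
  rw [range_encode hD hS hcov hq]
  refine polishSpace_inter_iInter (IsClosed.inter ?_ ?_) fun i => ?_
  · simp only [ofPred_forall]
    refine isClosed_iInter fun n => isClosed_iInter fun m => ?_
    -- The modulus is a discrete coordinate, so it can be frozen at each value `k` on a clopen set.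
    have : {p : (D → ℝ) × (ℕ → ℕ → ℕ) | OscLE (S n) m (p.2 n m) p.1} =
        ⋂ k, ({p | p.2 n m = k}ᶜ ∪ {p | OscLE (S n) m k p.1}) := by
      ext p
      simp [or_iff_not_imp_left]
    rw [this]
    exact isClosed_iInter fun k =>
      (isClopen_setOf_index (fun a _ => a = k) n n m).compl.isClosed.union
        ((isClosed_oscLE (S n) m k).preimage continuous_fst)
  · simp only [ofPred_forall]
    refine isClosed_iInter fun n => isClosed_iInter fun n' => isClosed_iInter fun m =>
      isClosed_iInter fun x => isClosed_iInter fun _ => isClosed_iInter fun x' =>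
      isClosed_iInter fun _ => isClosed_iInter fun _ => isClosed_iInter fun y =>
      isClosed_iInter fun y' => ?_
    exact isClosed_imp
      (isClopen_setOf_index (fun a _ => dist (y : M) x < 1 / (a + 1 : ℝ)) n n' m).isOpen
      (isClosed_imp
        (isClopen_setOf_index (fun _ a => dist (y' : M) x' < 1 / (a + 1 : ℝ)) n n' m).isOpen
        (isClosed_le (by fun_prop) continuous_const))
  -- Once the modulus is frozen at `k`, minimality is a finite intersection of open conditions.
  · have : {p : (D → ℝ) × (ℕ → ℕ → ℕ) | ∀ j < p.2 i.1 i.2, ¬ OscLE (S i.1) i.2 j p.1} =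
        ⋃ k, ({p | p.2 i.1 i.2 = k} ∩ ⋂ j ∈ Finset.range k, {p | OscLE (S i.1) i.2 j p.1}ᶜ) := by
      ext p
      simp
    rw [this]
    exact isOpen_iUnion fun k =>
      (isClopen_setOf_index (fun a _ => a = k) i.1 i.1 i.2).isOpen.inter
        (isOpen_biInter_finset fun j _ =>
          ((isClosed_oscLE (S i.1) i.2 j).preimage continuous_fst).isOpen_compl)

/-- The bijection from codes to continuous functions on `X`. -/
noncomputable def decode (hD : Dense D) (hq : IsQuotientMap q) :
    range (encode D S q) ≃ C(X, ℝ) :=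
  (Equiv.ofInjective _ (encode_injective hD hq)).symm

theorem encode_decode (hD : Dense D) (hq : IsQuotientMap q) (p : range (encode D S q)) :
    encode D S q (decode hD hq p) = p :=
  Equiv.apply_ofInjective_symm (encode_injective hD hq) p

/-- Codes sharing the `(n, m)` modulus of `p₀` form an open set on which one ball around `x₀` serves
all decoded functions. Values there are compared through a point `y ∈ D` of the ball, whose value is
a coordinate of the code: three errors below `ε / 3`. -/
theorem continuous_decode_eval (hD : Dense D) (hS : ∀ n, IsCompact (S n))
    (hcov : ⋃ n, S n = univ) (hq : IsQuotientMap q) :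
    Continuous fun w : M × range (encode D S q) => decode hD hq w.2 (q w.1) := by
  refine continuous_iff_continuousAt.2 fun ⟨x₀, p₀⟩ => Metric.tendsto_nhds.2 fun ε hε => ?_
  obtain ⟨n, hn⟩ := mem_iUnion.1 (hcov ▸ mem_univ x₀)
  obtain ⟨m, hm⟩ := exists_nat_one_div_lt (show 0 < ε / 3 by positivity)
  set r : ℝ := 1 / (p₀.1.2 n m + 1 : ℝ) with hr
  have hr0 : 0 < r := by positivity
  obtain ⟨y, hyx, hyD⟩ := hD.inter_open_nonempty (Metric.ball x₀ r) Metric.isOpen_ball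
    ⟨x₀, Metric.mem_ball_self hr0⟩
  have hval : ∀ p : range (encode D S q), decode hD hq p (q y) = p.1.1 ⟨y, hyD⟩ := fun p =>
    congrFun (congrArg Prod.fst (encode_decode hD hq p)) ⟨y, hyD⟩
  have hosc : ∀ p : range (encode D S q), p.1.2 n m = p₀.1.2 n m → ∀ z ∈ Metric.ball x₀ r,
      |decode hD hq p (q z) - decode hD hq p (q y)| ≤ 1 / (m + 1 : ℝ) := by
    intro p hp z hz
    have h := oscLE_encode (D := D) hq hS (decode hD hq p) n m
    rw [encode_decode, hp] at h
    have h' : OscLE (S n) m (p₀.1.2 n m) (fun y : D => decode hD hq p (q y)) := by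
      convert h using 1
      exact congrArg Prod.fst (encode_decode hD hq p)
    exact h'.abs_sub_le hD ((decode hD hq p).continuous.comp hq.continuous) hn hz hyx
  have hopen : IsOpen {p : range (encode D S q) |
      p.1.2 n m = p₀.1.2 n m ∧ |p.1.1 ⟨y, hyD⟩ - p₀.1.1 ⟨y, hyD⟩| < ε / 3} :=
    ((isClopen_setOf_index (fun a _ => a = p₀.1.2 n m) n n m).isOpen.preimage
      continuous_subtype_val).inter (isOpen_lt
        (((continuous_apply (⟨y, hyD⟩ : D)).comp
          (continuous_fst.comp continuous_subtype_val)).sub continuous_const).abs continuous_const)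
  filter_upwards [prod_mem_nhds (Metric.ball_mem_nhds x₀ hr0)
    (hopen.mem_nhds (x := p₀) ⟨rfl, by simpa using by positivity⟩)]
  rintro ⟨z, p⟩ ⟨hz, hpi, hpv⟩
  have h1 := hosc p hpi z hz
  have h2 := hosc p₀ rfl x₀ (Metric.mem_ball_self hr0)
  rw [← hval, ← hval] at hpv
  rw [abs_le] at h1 h2
  rw [abs_lt] at hpv
  rw [Real.dist_eq, abs_lt]
  constructor <;> dsimp only <;> linarith

/-- A Polish space is compactly coherent, so continuity may be tested on compact sets `Z` of codes.
As `Z` is locally compact, `q × id` on `M × Z` is still a quotient map, so joint continuity passes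
from `M × Z` to `X × Z`, and currying concludes. -/
theorem continuous_decode (hD : Dense D) (hDc : D.Countable) (hS : ∀ n, IsCompact (S n))
    (hcov : ⋃ n, S n = univ) (hq : IsQuotientMap q) :
    Continuous (decode (S := S) hD hq) := by
  have := polishSpace_range_encode hD hDc hS hcov hq
  refine continuous_def.2 fun U hU => CompactlyCoherentSpace.isOpen_iff.2 fun Z hZ => ?_
  have := isCompact_iff_compactSpace.1 hZ
  have hjoint : Continuous fun w : X × Z => decode hD hq w.2.1 w.1 :=
    hq.continuous_lift_prod_left
      ((continuous_decode_eval hD hS hcov hq).comp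
        (continuous_fst.prodMk (continuous_subtype_val.comp continuous_snd)))
  exact hU.preimage
    (ContinuousMap.continuous_of_continuous_uncurry (fun z : Z => decode hD hq z.1)
      (hjoint.comp continuous_swap))

/-- As `D` is countable, an oscillation bound is a countable conjunction of conditions `|f a - f b|
≤ c`, and its negation a countable union of strict ones. Countability of `T` in `hosc` matters for
the Fell topology, where each condition is only C_δ. -/
theorem preimage_encode_mem {𝓕 : Set (Set C(X, ℝ))} (h : IsSigmaLattice 𝓕) (hDc : D.Countable)
    (hS : ∀ n, IsCompact (S n)) (hq : IsQuotientMap q)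
    (hlt : ∀ x r, {f : C(X, ℝ) | f x < r} ∈ 𝓕) (hgt : ∀ x r, {f : C(X, ℝ) | r < f x} ∈ 𝓕)
    (hosc : ∀ (T : Set (X × X)) (c : ℝ), T.Countable →
      {f : C(X, ℝ) | ∀ t ∈ T, |f t.1 - f t.2| ≤ c} ∈ 𝓕)
    {U : Set ((D → ℝ) × (ℕ → ℕ → ℕ))} (hU : IsOpen U) : encode D S q ⁻¹' U ∈ 𝓕 := by
  have := hDc.to_subtype
  have hpairs : ∀ n m k, ∃ T : Set (X × X), T.Countable ∧ ∀ f : C(X, ℝ),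
      OscLE (S n) m k (fun y : D => f (q y)) ↔ ∀ t ∈ T, |f t.1 - f t.2| ≤ 1 / (m + 1 : ℝ) := by
    intro n m k
    refine ⟨(fun y : D × D => (q y.1, q y.2)) '' {y | ∃ x ∈ S n, dist (y.1 : M) x < 1 / (k + 1 : ℝ) ∧
      dist (y.2 : M) x < 1 / (k + 1 : ℝ)}, (to_countable _).image _, fun f => ?_⟩
    rw [forall_mem_image]
    exact ⟨fun H y ⟨x, hx, hy, hy'⟩ => H x hx _ _ hy hy',
      fun H x hx y y' hy hy' => H (x := (y, y')) ⟨x, hx, hy, hy'⟩⟩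
  have habs : ∀ (a b : X) (c : ℝ), {f : C(X, ℝ) | c < |f a - f b|} ∈ 𝓕 := by
    intro a b c
    simp only [lt_abs_sub_iff_exists_rat, ofPred_exists]
    exact h.iUnion_mem fun r => h.union_mem (h.inter_mem (hgt a _) (hlt b _))
      (h.inter_mem (hgt b _) (hlt a _))
  refine h.preimage_prodMk_mem (fun V hV => h.preimage_pi_mem (fun y W hW => ?_) hV)
    (fun V hV => h.preimage_pi_mem (fun n W hW => h.preimage_pi_mem (fun m O _ => ?_) hW) hV) hU
  · exact h.preimage_mem_of_real (hlt _) (hgt _) hW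
  · refine h.preimage_mem_of_nat fun k => ?_
    have heq : {f : C(X, ℝ) | oscIndex (S n) m (fun y : D => f (q y)) = k} =
        {f | OscLE (S n) m k (fun y : D => f (q y))} ∩
          ⋂ j ∈ Finset.range k, {f | ¬ OscLE (S n) m j (fun y : D => f (q y))} := by
      ext f
      simpa using oscIndex_eq_iff (exists_oscLE (hS n) (f.continuous.comp hq.continuous) m)
    rw [heq]
    refine h.inter_mem ?_ (h.biInter_finset_mem _ fun j _ => ?_)
    · obtain ⟨T, hT, hTf⟩ := hpairs n m k
      simp only [hTf]
      exact hosc T _ hT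
    · obtain ⟨T, hT, hTf⟩ := hpairs n m j
      have := hT.to_subtype
      have heq' : {f : C(X, ℝ) | ¬ OscLE (S n) m j (fun y : D => f (q y))} =
          ⋃ t : T, {f | 1 / (m + 1 : ℝ) < |f t.1.1 - f t.1.2|} := by
        ext f
        simp only [hTf, mem_ofPred_eq, mem_iUnion, not_forall, not_le, Subtype.exists, exists_prop]
      rw [heq']
      exact h.iUnion_mem fun t => habs _ _ _

end Encoding

end FunctionSpaceLusin
namespace FunctionSpaceLusin

/-! ### Evaluation sets in the three topologies -/

section FunctionSpaces

variable {X : Type u} [TopologicalSpace X]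

theorem continuous_cp_eval (x : X) : Continuous fun f : Cp X => f x :=
  (continuous_apply x).comp continuous_induced_dom

theorem continuous_toCp : Continuous fun f : C(X, ℝ) => (show Cp X from f) :=
  continuous_induced_rng.2 (continuous_pi fun x => continuous_eval_const x)

theorem continuous_toCFell : Continuous fun f : C(X, ℝ) => (show CFell X from f) := by
  refine continuous_generateFrom_iff.2 ?_
  rintro _ (⟨K, r, hK, -, rfl⟩ | ⟨U, r, -, -, rfl⟩)
  · exact ContinuousMap.isOpen_setOfPred_mapsTo hK isOpen_Iio
  · have : (fun f : C(X, ℝ) => (show CFell X from f)) ⁻¹' {f : CFell X | ∃ x ∈ U, r < f x} =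
        ⋃ x ∈ U, {f : C(X, ℝ) | r < f x} := by
      ext f
      simp only [mem_ofPred_eq, mem_iUnion, exists_prop]
      rfl
    rw [this]
    exact isOpen_biUnion fun x _ =>
      isOpen_lt continuous_const (continuous_eval_const x)

theorem isOpen_cFell_eval_lt (x : X) (r : ℝ) : IsOpen {f : CFell X | f x < r} :=
  TopologicalSpace.isOpen_generateFrom_of_mem
    (Or.inl ⟨{x}, r, isCompact_singleton, singleton_nonempty x, by simp⟩)

theorem setOf_lt_eq_iUnion {Y : Type*} (g : Y → ℝ) (r : ℝ) :
    {y | r < g y} = ⋃ s : {s : ℚ // r < s}, {y | (s : ℝ) ≤ g y} := by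
  ext y
  simp only [mem_ofPred_eq, mem_iUnion]
  constructor
  · intro h
    obtain ⟨s, h1, h2⟩ := exists_rat_btwn h
    exact ⟨⟨s, h1⟩, h2.le⟩
  · rintro ⟨s, hs⟩
    exact s.2.trans_le hs

theorem fSigma_setOf_lt {Y : Type u} [TopologicalSpace Y] {g g' : Y → ℝ} (hg : Continuous g)
    (hg' : Continuous g') : FSigma Y {y | g y < g' y} := by
  have : {y | g y < g' y} = {y | 0 < g' y - g y} := by simp
  rw [this, setOf_lt_eq_iUnion]
  exact isSigmaLattice_fSigma.iUnion_mem fun s =>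
    (isClosed_le continuous_const (hg'.sub hg)).fSigma

theorem constructible_cFell_le_eval (x : X) (r : ℝ) :
    Constructible (CFell X) {f : CFell X | r ≤ f x} := by
  convert! (Constructible.of_isOpen (isOpen_cFell_eval_lt x r)).compl using 1
  ext f
  simp

theorem cDeltaSigma_cFell_lt_eval (x : X) (r : ℝ) :
    CDeltaSigma (CFell X) {f : CFell X | r < f x} := by
  rw [setOf_lt_eq_iUnion]
  exact isSigmaLattice_cDeltaSigma.iUnion_mem fun s =>
    (constructible_cFell_le_eval x s).cDelta.cDeltaSigma

/-- The inequality fails exactly when rationals `s > r + c` satisfy `s ≤ f a` and `f b < r`, or the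
same with `a` and `b` exchanged. Using `s ≤ f a` makes each forbidden set closed ∩ open, hence
constructible. -/
theorem cDelta_cFell_abs_sub_le (a b : X) (c : ℝ) :
    CDelta (CFell X) {f : CFell X | |f a - f b| ≤ c} := by
  have : {f : CFell X | |f a - f b| ≤ c} = ⋂ p : {p : ℚ × ℚ // p.2 + c < (p.1 : ℝ)},
      ({f : CFell X | (p.1.1 : ℝ) ≤ f a} ∩ {f | f b < p.1.2})ᶜ ∩
        ({f : CFell X | (p.1.1 : ℝ) ≤ f b} ∩ {f | f a < p.1.2})ᶜ := by
    ext f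
    simp only [mem_ofPred_eq, mem_iInter, mem_inter_iff, mem_compl_iff, not_and, not_lt]
    constructor
    · rintro h ⟨⟨s, r⟩, hsr⟩
      rw [abs_le] at h
      dsimp only at hsr ⊢
      exact ⟨fun h' => by linarith, fun h' => by linarith⟩
    · intro h
      by_contra! hlt
      obtain ⟨r, h' | h'⟩ := lt_abs_sub_iff_exists_rat.1 hlt
      · obtain ⟨s, hs1, hs2⟩ := exists_rat_btwn h'.1
        exact absurd ((h ⟨(s, r), hs1⟩).1 hs2.le) (not_le.2 h'.2)
      · obtain ⟨s, hs1, hs2⟩ := exists_rat_btwn h'.1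
        exact absurd ((h ⟨(s, r), hs1⟩).2 hs2.le) (not_le.2 h'.2)
  rw [this]
  have hc : ∀ (a b : X) (s r : ℝ),
      Constructible (CFell X) ({f : CFell X | s ≤ f a} ∩ {f | f b < r})ᶜ := fun a b s r =>
    ((constructible_cFell_le_eval a s).inter (.of_isOpen (isOpen_cFell_eval_lt b r))).compl
  exact CDelta.iInter fun p => ((hc _ _ _ _).inter (hc _ _ _ _)).cDelta

end FunctionSpaces

theorem FSigma.exists_isCompact_cover {K : Type u} [TopologicalSpace K] [CompactSpace K]
    {M : Set K} (hM : FSigma K M) :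
    ∃ S : ℕ → Set M, (∀ n, IsCompact (S n)) ∧ ⋃ n, S n = univ := by
  obtain ⟨F, hF, rfl⟩ := hM
  refine ⟨fun n => Subtype.val ⁻¹' F n, fun n => ?_, ?_⟩
  · exact IsInducing.subtypeVal.isCompact_preimage' (hF n).isCompact
      (Subtype.range_coe.symm ▸ subset_iUnion F n)
  · rw [← preimage_iUnion]
    exact Subtype.coe_preimage_self _

end FunctionSpaceLusin

/-! ### The Lusin property of the three function spaces -/

theorem lemma5p1 (X : Type u) [TopologicalSpace X] [T35Space X]
    (hX : FunctionSpaceLusin.IsQuotientOfClass FunctionSpaceLusin.FSigma X) :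
    FunctionSpaceLusin.IsLusinOfClass FunctionSpaceLusin.FSigma (FunctionSpaceLusin.Cp X) ∧
    FunctionSpaceLusin.IsLusinOfClass FunctionSpaceLusin.FSigma (FunctionSpaceLusin.Ck X) ∧
    FunctionSpaceLusin.IsLusinOfClass FunctionSpaceLusin.CDeltaSigma
      (FunctionSpaceLusin.CFell X) := by
  open FunctionSpaceLusin in
  obtain ⟨K, _, _, _, M, q, hM, hq⟩ := hX
  let _ := TopologicalSpace.metrizableSpaceMetric K
  obtain ⟨S, hS, hcov⟩ := hM.exists_isCompact_cover
  obtain ⟨D, hDc, hD⟩ := TopologicalSpace.exists_countable_dense M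
  have hP := polishSpace_range_encode hD hDc hS hcov hq
  have hcont := continuous_decode hD hDc hS hcov hq
  have hmeas : ∀ {𝓕 : Set (Set C(X, ℝ))}, IsSigmaLattice 𝓕 →
      (∀ x r, {f : C(X, ℝ) | f x < r} ∈ 𝓕) → (∀ x r, {f : C(X, ℝ) | r < f x} ∈ 𝓕) →
      (∀ (T : Set (X × X)) (c : ℝ), T.Countable →
        {f : C(X, ℝ) | ∀ t ∈ T, |f t.1 - f t.2| ≤ c} ∈ 𝓕) →
      ∀ U, IsOpen U → (decode (S := S) hD hq).symm ⁻¹' U ∈ 𝓕 := by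
    rintro 𝓕 h hlt hgt hosc _ ⟨V, hV, rfl⟩
    exact preimage_encode_mem h hDc hS hq hlt hgt hosc hV
  -- The same bijection serves all three spaces; only the topology on the target changes.
  let eCp : range (encode D S q) ≃ Cp X := decode hD hq
  let eCFell : range (encode D S q) ≃ CFell X := decode hD hq
  have hCp : Continuous eCp := continuous_toCp.comp hcont
  have hCFell : Continuous eCFell := continuous_toCFell.comp hcont
  refine ⟨⟨range (encode D S q), inferInstance, hP, eCp, hCp,
      hmeas (𝓕 := {A | FSigma (Cp X) A}) (isSigmaLattice_fSigma (Y := Cp X)) ?_ ?_ ?_⟩,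
    ⟨range (encode D S q), inferInstance, hP, decode hD hq, hcont,
      hmeas (𝓕 := {A | FSigma (Ck X) A}) isSigmaLattice_fSigma ?_ ?_ ?_⟩,
    ⟨range (encode D S q), inferInstance, hP, eCFell, hCFell,
      hmeas (𝓕 := {A | CDeltaSigma (CFell X) A})
        (isSigmaLattice_cDeltaSigma (Y := CFell X)) ?_ ?_ ?_⟩⟩
  · exact fun x r => fSigma_setOf_lt (continuous_cp_eval x) continuous_const
  · exact fun x r => fSigma_setOf_lt continuous_const (continuous_cp_eval x)
  · intro T c _
    have : IsClosed {f : Cp X | ∀ t ∈ T, |f t.1 - f t.2| ≤ c} := by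
      simp only [ofPred_forall]
      exact isClosed_iInter fun t => isClosed_iInter fun _ => isClosed_le
        ((continuous_cp_eval t.1).sub (continuous_cp_eval t.2)).abs continuous_const
    exact this.fSigma
  · exact fun x r => fSigma_setOf_lt (continuous_eval_const x) continuous_const
  · exact fun x r => fSigma_setOf_lt continuous_const (continuous_eval_const x)
  · intro T c _
    have : IsClosed {f : Ck X | ∀ t ∈ T, |f t.1 - f t.2| ≤ c} := by
      simp only [ofPred_forall]
      exact isClosed_iInter fun t => isClosed_iInter fun _ => isClosed_le
        ((continuous_eval_const t.1).sub
          (continuous_eval_const t.2)).abs continuous_const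
    exact this.fSigma
  · exact fun x r => (Constructible.of_isOpen (isOpen_cFell_eval_lt x r)).cDelta.cDeltaSigma
  · exact fun x r => cDeltaSigma_cFell_lt_eval x r
  · intro T c hT
    have := hT.to_subtype
    have h : CDelta (CFell X) (⋂ t : T, {f : CFell X | |f t.1.1 - f t.1.2| ≤ c}) :=
      CDelta.iInter fun t => cDelta_cFell_abs_sub_le _ _ c
    have heq : {f : CFell X | ∀ t ∈ T, |f t.1 - f t.2| ≤ c} =
        ⋂ t : T, {f : CFell X | |f t.1.1 - f t.1.2| ≤ c} := by
      ext f
      simp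
    exact (heq ▸ h).cDeltaSigma
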